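/- Let $X$ be a locally compact, $\sigma$-compact, second countable Hausdorff space, $\mathcal B$ its Borel $\sigma$-algebra, $\mu$ a locally finite Borel measure on $X$, and $1\le p<\infty$. Let $f:X\to X$ be a bijection such that $f$ and $f^{-1}$ are Borel measurable, the measures $\mu\circ f: B\mapsto \mu(f(B))$ and $\mu\circ f^{-1}: B\mapsto\mu(f^{-1}(B))$ are absolutely continuous with respect to $\mu$, and both Radon–Nikodym derivatives $\frac{d(\mu\circ f)}{d\mu}$ and $\frac{d(\mu\circ f^{-1})}{d\mu}$ are bounded from below $\mu$-a.e. by a positive constant. Let $T_f:L^p(X,\mu;\mathbb C)\to L^p(X,\mu;\mathbb C)$, $T_f\varphi=\varphi\circ f$, be the associated (bounded linear) composition operator. Suppose that the system is * dissipative, generated by $W$: $W\in\mathcal B$, $0<\mu(W)<\infty$, and $X$ is the disjoint union of the sets $f^k(W)$, $k\in\mathbb Z$; * of bounded distortion: there is $K>0$ such that $$\tfrac1K\,\mu(f^k(W))\,\mu(B)\le \mu(f^k(B))\,\mu(W)\le K\,\mu(f^k(W))\,\mu(B)$$ for all $k\in\mathbb Z$ and all $B\in\mathcal B$ with $B\subseteq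 W$ and $\mu(B)>0$. Call $T_f$ $\mathbb C$-supercyclic if there is $\varphi\in L^p(X,\mu;\mathbb C)$ such that $\{\lambda T_f^n\varphi : n\ge 0,\ \lambda\in\mathbb C\}$ is dense in $L^p(X,\mu;\mathbb C)$. Then $T_f$ is $\mathbb C$-supercyclic if and only if, for every $q\in\mathbb N$, $$\liminf_{n\to+\infty}\ \mu(f^{q-n}(W))\cdot\mu(f^{q+n}(W))=0.$$ Equivalently, $T_f$ is $\mathbb C$-supercyclic if and only if $$\liminf_{n\to+\infty}\ \mu(f^{-n}(W))\cdot\mu(f^{n}(W))=0.$$ -/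

import Mathlib

open MeasureTheory Filter
open scoped ENNReal NNReal

noncomputable section

/-- `T` is `ℂ`-supercyclic: some vector `x` has a dense projective orbit
`{lam • T ^ n x : n ≥ 0, lam ∈ ℂ}`. -/
def IsComplexSupercyclic {E : Type*} [NormedAddCommGroup E] [NormedSpace ℂ E]
    (T : E →L[ℂ] E) : Prop :=
  ∃ x : E, Dense {y : E | ∃ (n : ℕ) (lam : ℂ), y = lam • (T ^ n) x}

/-- The standing assumptions on a bijective bimeasurable map `f` of `(X, μ)` under which composition
with `f` is a bounded invertible operator on `L^p`. The measure `μ ∘ f : B ↦ μ (f '' B)` is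
`μ.map f.symm`, and `μ ∘ f⁻¹ : B ↦ μ (f ⁻¹' B)` is `μ.map f`. Both have a Radon-Nikodym derivative
with respect to `μ`, bounded from below by a positive constant. -/
structure IsCompositionSystem {X : Type*} [MeasurableSpace X] (μ : Measure X) (f : X ≃ᵐ X) :
    Prop where
  absolutelyContinuous_image : μ.map f.symm ≪ μ
  absolutelyContinuous_preimage : μ.map f ≪ μ
  rnDeriv_image_bddBelow :
    ∃ c : ℝ≥0, 0 < c ∧ ∀ᵐ x ∂μ, (c : ℝ≥0∞) ≤ (μ.map f.symm).rnDeriv μ x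
  rnDeriv_preimage_bddBelow :
    ∃ c : ℝ≥0, 0 < c ∧ ∀ᵐ x ∂μ, (c : ℝ≥0∞) ≤ (μ.map f).rnDeriv μ x

/-- `f ^ k (A)` for an integer `k` (for `k < 0`, the image under the `|k|`-th iterate of `f⁻¹`). -/
def iterImage {X : Type*} [MeasurableSpace X] (f : X ≃ᵐ X) (k : ℤ) (A : Set X) : Set X :=
  ((f.toEquiv : Equiv.Perm X) ^ k) '' A

/-- The system is dissipative, generated by `W`: the set `W` is measurable of positive finite
measure and `X` is the disjoint union of the sets `f ^ k (W)`, `k ∈ ℤ`. -/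
structure IsDissipativeGeneratedBy {X : Type*} [MeasurableSpace X] (μ : Measure X) (f : X ≃ᵐ X)
    (W : Set X) : Prop where
  measurableSet : MeasurableSet W
  measure_pos : 0 < μ W
  measure_lt_top : μ W < ∞
  pairwise_disjoint : Pairwise fun j k : ℤ => Disjoint (iterImage f j W) (iterImage f k W)
  iUnion_eq : ⋃ k : ℤ, iterImage f k W = Set.univ

/-- Bounded distortion on `W`. -/
def HasBoundedDistortion {X : Type*} [MeasurableSpace X] (μ : Measure X) (f : X ≃ᵐ X)
    (W : Set X) : Prop :=
  ∃ K : ℝ≥0, 0 < K ∧ ∀ (k : ℤ) (B : Set X), MeasurableSet B → B ⊆ W → 0 < μ B →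
    (K : ℝ≥0∞)⁻¹ * (μ (iterImage f k W) * μ B) ≤ μ (iterImage f k B) * μ W ∧
    μ (iterImage f k B) * μ W ≤ (K : ℝ≥0∞) * (μ (iterImage f k W) * μ B)

namespace IsCompositionSystem

variable {X : Type*} [MeasurableSpace X] {μ : Measure X} {f : X ≃ᵐ X}

theorem exists_map_le (hf : IsCompositionSystem μ f) :
    ∃ C : ℝ≥0∞, C ≠ ∞ ∧ μ.map f ≤ C • μ := by
  obtain ⟨c, hc, h⟩ := hf.rnDeriv_image_bddBelow
  have hc0 : (c : ℝ≥0∞) ≠ 0 := by exact_mod_cast hc.ne'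
  have h1 : (c : ℝ≥0∞) • μ ≤ μ.map f.symm := by
    rw [← withDensity_const]
    exact (withDensity_mono h).trans (Measure.withDensity_rnDeriv_le _ _)
  refine ⟨(c : ℝ≥0∞)⁻¹, ENNReal.inv_ne_top.2 hc0, Measure.le_iff.2 fun s hs => ?_⟩
  have h2 := h1 (f ⁻¹' s)
  rw [MeasurableEquiv.map_apply] at h2
  have h3 : f.symm ⁻¹' (f ⁻¹' s) = s := by
    ext x; simp
  rw [h3] at h2
  rw [MeasurableEquiv.map_apply]
  simp only [Measure.smul_apply, smul_eq_mul] at h2 ⊢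
  rw [mul_comm, ← div_eq_mul_inv]
  exact (ENNReal.le_div_iff_mul_le (Or.inl hc0) (Or.inl ENNReal.coe_ne_top)).2
    (by rwa [mul_comm])

theorem quasiMeasurePreserving (hf : IsCompositionSystem μ f) :
    Measure.QuasiMeasurePreserving f μ μ :=
  ⟨f.measurable, hf.absolutelyContinuous_preimage⟩

theorem memLp_comp (hf : IsCompositionSystem μ f) {p : ℝ≥0∞} {φ : X → ℂ} (hφ : MemLp φ p μ) :
    MemLp (φ ∘ f) p μ := by
  obtain ⟨C, hC, h⟩ := hf.exists_map_le
  exact (f.measurableEmbedding.memLp_map_measure_iff).1 (hφ.of_measure_le_smul hC h)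

theorem exists_eLpNorm_comp_le (hf : IsCompositionSystem μ f) (p : ℝ≥0∞) :
    ∃ M : ℝ≥0, ∀ φ : X → ℂ, eLpNorm (φ ∘ f) p μ ≤ M * eLpNorm φ p μ := by
  obtain ⟨C, hC, h⟩ := hf.exists_map_le
  refine ⟨(C ^ (1 / p).toReal).toNNReal, fun φ => ?_⟩
  rw [ENNReal.coe_toNNReal (ENNReal.rpow_ne_top_of_nonneg ENNReal.toReal_nonneg hC),
    ← f.measurableEmbedding.eLpNorm_map_measure]
  exact eLpNorm_le_of_measure_le_smul h

/-- The linear map `φ ↦ φ ∘ f` on `L^p(X, μ; ℂ)`. -/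
def compositionLinearMap (hf : IsCompositionSystem μ f) (p : ℝ≥0∞) : Lp ℂ p μ →ₗ[ℂ] Lp ℂ p μ where
  toFun φ := (hf.memLp_comp (Lp.memLp φ)).toLp (φ ∘ f)
  map_add' φ ψ := by
    rw [← MemLp.toLp_add]
    exact MemLp.toLp_congr _ _ (hf.quasiMeasurePreserving.ae_eq_comp (Lp.coeFn_add φ ψ))
  map_smul' a φ := by
    rw [RingHom.id_apply, ← MemLp.toLp_const_smul]
    exact MemLp.toLp_congr _ _ (hf.quasiMeasurePreserving.ae_eq_comp (Lp.coeFn_smul a φ))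

theorem exists_norm_compositionLinearMap_le (hf : IsCompositionSystem μ f) (p : ℝ≥0∞)
    [Fact (1 ≤ p)] :
    ∃ M : ℝ, ∀ φ : Lp ℂ p μ, ‖hf.compositionLinearMap p φ‖ ≤ M * ‖φ‖ := by
  obtain ⟨M, hM⟩ := hf.exists_eLpNorm_comp_le p
  refine ⟨M, fun φ => ?_⟩
  have h1 : ‖hf.compositionLinearMap p φ‖ = (eLpNorm (φ ∘ f) p μ).toReal :=
    Lp.norm_toLp _ (hf.memLp_comp (Lp.memLp φ))
  rw [h1, Lp.norm_def, ← ENNReal.coe_toReal, ← ENNReal.toReal_mul]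
  exact ENNReal.toReal_mono (ENNReal.mul_ne_top ENNReal.coe_ne_top (Lp.memLp φ).2.ne) (hM φ)

/-- The composition operator `T_f φ = φ ∘ f`, a bounded linear operator on `L^p(X, μ; ℂ)`. -/
def compositionOperator (hf : IsCompositionSystem μ f) (p : ℝ≥0∞) [Fact (1 ≤ p)] :
    Lp ℂ p μ →L[ℂ] Lp ℂ p μ where
  toLinearMap := hf.compositionLinearMap p
  cont := AddMonoidHomClass.continuous_of_bound _ _
    (hf.exists_norm_compositionLinearMap_le p).choose_spec

theorem coeFn_compositionOperator (hf : IsCompositionSystem μ f) (p : ℝ≥0∞) [Fact (1 ≤ p)]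
    (φ : Lp ℂ p μ) : hf.compositionOperator p φ =ᵐ[μ] φ ∘ f :=
  MemLp.coeFn_toLp (hf.memLp_comp (Lp.memLp φ))

end IsCompositionSystem

end

/-!
Write `aₖ = μ (f ^ k (W))`. The blocks `f ^ k (W)` partition `X`, and bounded distortion says that,
up to a constant, composition with `f ^ n` multiplies the integral of any nonnegative function over
`f ^ (k + n) (W)` by `aₖ / aₖ₊ₙ`: this is `IsCompositionSystem.exists_setLIntegral_comp_le`. The
operator thus acts on the blocks like a bilateral weighted shift. The bounds on the Radon-Nikodym
derivatives make consecutive `aₖ` comparable (`exists_measure_iterImage_add_le`), which also gives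
the equivalence of the conditions for all centres `q` with the one for `q = 0`.

If `a₋ₙ aₙ` comes arbitrarily close to `0`, let `x` and `y` be supported on finitely many blocks.
Then `‖T ^ n x‖ ^ p` is at most a multiple of `a₋ₙ` and `‖T ^ (-n) y‖ ^ p` at most a multiple of
`aₙ`. With a scalar `s` such that `s ^ p = √(aₙ / a₋ₙ)`, the vector `x + s⁻¹ T ^ (-n) y` is close to
`x` and its image under `s T ^ n` is close to `y`. Such vectors being dense
(`IsCompositionSystem.dense_norm_pow_le`), projective orbits are topologically transitive, and a
Baire category argument yields a supercyclic vector (`isComplexSupercyclic_of_dense_bounds`).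

Conversely, a supercyclic invertible operator has, for arbitrarily large `n`, a vector `x` such that
both `x` and some multiple `λ T ^ n x` are `ε`-close to the indicator of `W`
(`IsComplexSupercyclic.exists_approx`). Then `x` has norm of order `1` on `W` and at most `ε` on
`f ^ n (W)`, while `λ T ^ n x` has norm of order `1` on `W` and at most `ε` on `f ^ (-n) (W)`.
Block comparison bounds `aₙ` by a multiple of `ε ^ p |λ| ^ p`, and `a₋ₙ` by a multiple of
`ε ^ p |λ| ^ (-p)`; in the product the scalar disappears
(`IsCompositionSystem.frequently_measure_mul_lt`).
-/

/-! ### Supercyclicity of operators on Banach spaces -/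

section Abstract

variable {E : Type*} [NormedAddCommGroup E] [NormedSpace ℂ E]

/-- Birkhoff transitivity for projective orbits: on a separable Banach space, the vectors with a
dense projective orbit form a countable intersection of dense open sets. -/
theorem isComplexSupercyclic_of_transitive [CompleteSpace E] [SecondCountableTopology E]
    (T : E →L[ℂ] E)
    (h : ∀ U V : Set E, IsOpen U → U.Nonempty → IsOpen V → V.Nonempty →
      ∃ x ∈ U, ∃ (n : ℕ) (lam : ℂ), lam • (T ^ n) x ∈ V) :
    IsComplexSupercyclic T := by
  let G : Set E → Set E := fun V => ⋃ (n : ℕ) (lam : ℂ), (fun x => lam • (T ^ n) x) ⁻¹' V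
  have hopen : ∀ V ∈ TopologicalSpace.countableBasis E, IsOpen (G V) := fun V hV =>
    isOpen_iUnion fun n => isOpen_iUnion fun lam =>
      (TopologicalSpace.isOpen_of_mem_countableBasis hV).preimage (by fun_prop)
  have hdense : ∀ V ∈ TopologicalSpace.countableBasis E, Dense (G V) := by
    intro V hV
    refine dense_iff_inter_open.2 fun U hU hUne => ?_
    obtain ⟨x, hx, n, lam, hV'⟩ := h U V hU hUne
      (TopologicalSpace.isOpen_of_mem_countableBasis hV)
      (TopologicalSpace.nonempty_of_mem_countableBasis hV)
    exact ⟨x, hx, Set.mem_iUnion₂.2 ⟨n, lam, hV'⟩⟩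
  obtain ⟨x, hx⟩ :=
    (dense_biInter_of_isOpen hopen (TopologicalSpace.countable_countableBasis E) hdense).nonempty
  refine ⟨x, (TopologicalSpace.isBasis_countableBasis E).dense_iff.2 fun V hV hne => ?_⟩
  obtain ⟨n, lam, hV'⟩ := Set.mem_iUnion₂.1 (Set.mem_iInter₂.1 hx V hV)
  exact ⟨lam • (T ^ n) x, hV', n, lam, rfl⟩

/-- A supercyclicity criterion for an operator `T` with right inverse `S`: it suffices that
`‖T ^ n x‖` and `‖S ^ n y‖` are controlled, for `x` and `y` in dense sets, by weights whose product
comes arbitrarily close to `0`. -/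
theorem isComplexSupercyclic_of_dense_bounds [CompleteSpace E] [SecondCountableTopology E]
    (T S : E →L[ℂ] E) (hTS : ∀ x, T (S x) = x) {r : ℝ} (hr : 0 < r) {u v : ℕ → ℝ}
    (hu : ∀ n, 0 < u n) (hv : ∀ n, 0 < v n) (huv : ∀ δ > 0, ∃ n, v n * u n < δ)
    (hT : Dense {x : E | ∃ C : ℝ, ∀ n : ℕ, ‖(T ^ n) x‖ ^ r ≤ C * v n})
    (hS : Dense {x : E | ∃ C : ℝ, ∀ n : ℕ, ‖(S ^ n) x‖ ^ r ≤ C * u n}) :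
    IsComplexSupercyclic T := by
  have hTSn : ∀ (n : ℕ) (x : E), (T ^ n) ((S ^ n) x) = x := by
    intro n
    induction n with
    | zero => simp
    | succ n ih =>
      intro x
      rw [pow_succ, pow_succ', mul_apply_eq_comp, mul_apply_eq_comp, hTS,
        ih]
  refine isComplexSupercyclic_of_transitive T fun U V hU hUne hV hVne => ?_
  obtain ⟨x, hxU, C, hC⟩ := hT.inter_open_nonempty U hU hUne
  obtain ⟨y, hyV, D, hD⟩ := hS.inter_open_nonempty V hV hVne
  obtain ⟨ε, hε, hεU⟩ := Metric.isOpen_iff.1 hU x hxU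
  obtain ⟨η, hη, hηV⟩ := Metric.isOpen_iff.1 hV y hyV
  set M : ℝ := |C| + |D| + 1 with hM
  have hMC : C ≤ M := by
    rw [hM]; linarith [le_abs_self C, abs_nonneg D]
  have hMD : D ≤ M := by
    rw [hM]; linarith [le_abs_self D, abs_nonneg C]
  have hMpos : 0 < M := by positivity
  set ρ : ℝ := min ε η
  have hρpos : 0 < ρ := lt_min hε hη
  have hρr : 0 < ρ ^ r / M := by positivity
  obtain ⟨n, hn⟩ := huv ((ρ ^ r / M) ^ 2) (by positivity)
  have hun := hu n
  have hvn := hv n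
  -- The scalar `s` is chosen so that `s ^ r * v n = (s ^ r)⁻¹ * u n = √(v n * u n)`.
  set t : ℝ := √(v n * u n) with ht
  have htpos : 0 < t := Real.sqrt_pos.2 (by positivity)
  have htt : t * t = v n * u n := Real.mul_self_sqrt (by positivity)
  have htlt : t < ρ ^ r / M := by
    rw [ht, Real.sqrt_lt' hρr]; exact hn
  set s : ℝ := (t / v n) ^ (r⁻¹) with hs
  have hspos : 0 < s := by positivity
  have hsr : s ^ r = t / v n := Real.rpow_inv_rpow (by positivity) hr.ne'
  have hMt : M * t < ρ ^ r := by
    rw [lt_div_iff₀ hMpos] at htlt; linarith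
  have h1 : ‖(s : ℂ) • (T ^ n) x‖ < ρ := by
    refine lt_of_not_ge fun hge => ?_
    have := Real.rpow_le_rpow hρpos.le hge hr.le
    rw [norm_smul, Real.mul_rpow (norm_nonneg _) (norm_nonneg _), Complex.norm_real,
      Real.norm_of_nonneg hspos.le, hsr] at this
    have h2 : t / v n * ‖(T ^ n) x‖ ^ r ≤ t / v n * (M * v n) := by
      refine mul_le_mul_of_nonneg_left ((hC n).trans ?_) (by positivity)
      gcongr
    have h3 : t / v n * (M * v n) = M * t := by field_simp
    linarith
  have h2 : ‖(s : ℂ)⁻¹ • (S ^ n) y‖ < ρ := by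
    refine lt_of_not_ge fun hge => ?_
    have := Real.rpow_le_rpow hρpos.le hge hr.le
    rw [norm_smul, Real.mul_rpow (norm_nonneg _) (norm_nonneg _), norm_inv, Complex.norm_real,
      Real.norm_of_nonneg hspos.le, Real.inv_rpow hspos.le, hsr] at this
    have h2 : (t / v n)⁻¹ * ‖(S ^ n) y‖ ^ r ≤ (t / v n)⁻¹ * (M * u n) := by
      refine mul_le_mul_of_nonneg_left ((hD n).trans ?_) (by positivity)
      gcongr
    have h3 : (t / v n)⁻¹ * (M * u n) = M * t := by
      rw [inv_div, div_mul_eq_mul_div, div_eq_iff htpos.ne']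
      linear_combination (-M) * htt
    linarith
  have hs0 : (s : ℂ) ≠ 0 := by exact_mod_cast hspos.ne'
  refine ⟨x + (s : ℂ)⁻¹ • (S ^ n) y, hεU ?_, n, s, hηV ?_⟩
  · rw [Metric.mem_ball, dist_eq_norm, add_sub_cancel_left]
    exact h2.trans_le (min_le_left _ _)
  · rw [Metric.mem_ball, dist_eq_norm, map_add, map_smul, hTSn, smul_add, smul_inv_smul₀ hs0,
      add_sub_cancel_right]
    exact h1.trans_le (min_le_right _ _)

/-- If `T` is surjective and supercyclic, then every nonzero vector `z` is nearly recurrent up to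
scalars along arbitrarily large times: the tail of a dense projective orbit is its image under a
power of `T`, hence is dense too. -/
theorem IsComplexSupercyclic.exists_approx {T : E →L[ℂ] E} (h : IsComplexSupercyclic T)
    (hT : Function.Surjective T) {z : E} (hz : z ≠ 0) {ε : ℝ} (hε : 0 < ε) (N : ℕ) :
    ∃ n ≥ N, ∃ (x : E) (lam : ℂ), ‖x - z‖ < ε ∧ ‖lam • (T ^ n) x - z‖ < ε := by
  obtain ⟨φ, hφ⟩ := h
  have hopen : IsOpen (Metric.ball z ε ∩ {0}ᶜ) :=
    Metric.isOpen_ball.inter isOpen_compl_singleton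
  obtain ⟨x, ⟨hxz, hx0⟩, n, lam, rfl⟩ :=
    hφ.inter_open_nonempty _ hopen ⟨z, Metric.mem_ball_self hε, hz⟩
  have hlam : lam ≠ 0 := by
    rintro rfl
    simp at hx0
  have hsurj : Function.Surjective (T ^ (n + N)) := by
    rw [FunLike.coe_pow_eq_iterate]
    exact hT.iterate _
  obtain ⟨_, hw, _, ⟨m, lam', rfl⟩, rfl⟩ :=
    (hsurj.denseRange.dense_image (T ^ (n + N)).continuous hφ).inter_open_nonempty _
      Metric.isOpen_ball ⟨z, Metric.mem_ball_self hε⟩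
  refine ⟨m + N, by omega, lam • (T ^ n) φ, lam' * lam⁻¹, ?_, ?_⟩
  · rwa [← dist_eq_norm]
  · rw [Metric.mem_ball, dist_eq_norm] at hw
    have key : (lam' * lam⁻¹) • (T ^ (m + N)) (lam • (T ^ n) φ) =
        (T ^ (n + N)) (lam' • (T ^ m) φ) := by
      rw [map_smul, map_smul, smul_smul, mul_assoc, inv_mul_cancel₀ hlam, mul_one,
        ← mul_apply_eq_comp, ← mul_apply_eq_comp, ← pow_add, ← pow_add,
        show m + N + n = n + N + m by omega]
    rwa [key]

end Abstract

/-! ### Integer iterates and the measures of the blocks -/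

section Iterates

variable {X : Type*} [MeasurableSpace X]

theorem measurable_toEquiv_zpow (f : X ≃ᵐ X) (k : ℤ) :
    Measurable ((f.toEquiv : Equiv.Perm X) ^ k) := by
  cases k with
  | ofNat n =>
    rw [Int.ofNat_eq_natCast, zpow_natCast, Equiv.Perm.coe_pow]
    exact f.measurable.iterate n
  | negSucc n =>
    rw [zpow_negSucc, ← inv_pow, Equiv.Perm.coe_pow]
    exact f.symm.measurable.iterate (n + 1)

/-- The integer iterate `f ^ k` as a measurable equivalence. -/
noncomputable def iterEquiv (f : X ≃ᵐ X) (k : ℤ) : X ≃ᵐ X where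
  toEquiv := (f.toEquiv : Equiv.Perm X) ^ k
  measurable_toFun := measurable_toEquiv_zpow f k
  measurable_invFun := by
    have h : ((f.toEquiv : Equiv.Perm X) ^ k).symm = (f.toEquiv : Equiv.Perm X) ^ (-k) :=
      (zpow_neg _ _).symm
    rw [h]
    exact measurable_toEquiv_zpow f (-k)

variable (f : X ≃ᵐ X)

theorem coe_iterEquiv (k : ℤ) : ⇑(iterEquiv f k) = ⇑((f.toEquiv : Equiv.Perm X) ^ k) := rfl

theorem iterEquiv_add_apply (j k : ℤ) (x : X) :
    iterEquiv f (j + k) x = iterEquiv f j (iterEquiv f k x) := by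
  simp only [coe_iterEquiv, zpow_add, Equiv.Perm.mul_apply]

theorem iterEquiv_zero_apply (x : X) : iterEquiv f 0 x = x := by
  simp [coe_iterEquiv]

theorem iterEquiv_natCast (n : ℕ) : ⇑(iterEquiv f n) = f^[n] := by
  rw [coe_iterEquiv, zpow_natCast, Equiv.Perm.coe_pow]
  rfl

theorem iterEquiv_one : ⇑(iterEquiv f 1) = f := by
  simpa using iterEquiv_natCast f 1

theorem iterEquiv_neg_one : ⇑(iterEquiv f (-1)) = f.symm := by
  rw [coe_iterEquiv, zpow_neg_one]
  rfl

theorem iterImage_eq_preimage (k : ℤ) (A : Set X) :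
    iterImage f k A = iterEquiv f (-k) ⁻¹' A := by
  rw [iterImage, coe_iterEquiv, zpow_neg]
  exact Equiv.image_eq_preimage_symm _ _

theorem iterImage_zero (A : Set X) : iterImage f 0 A = A := by
  simp [iterImage]

theorem preimage_iterImage (n k : ℤ) (A : Set X) :
    iterEquiv f n ⁻¹' iterImage f k A = iterImage f (k - n) A := by
  ext x
  simp only [iterImage_eq_preimage, Set.mem_preimage, ← iterEquiv_add_apply]
  rw [show -k + n = -(k - n) by ring]

theorem iterImage_symm (k : ℤ) (A : Set X) : iterImage f.symm k A = iterImage f (-k) A := by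
  have h : (f.symm.toEquiv : Equiv.Perm X) = (f.toEquiv : Equiv.Perm X)⁻¹ := rfl
  rw [iterImage, iterImage, h, inv_zpow']

variable {f}

theorem measurableSet_iterImage {A : Set X} (hA : MeasurableSet A) (k : ℤ) :
    MeasurableSet (iterImage f k A) := by
  rw [iterImage_eq_preimage]
  exact (iterEquiv f (-k)).measurable hA

variable {μ : Measure X} {W : Set X}

theorem IsCompositionSystem.symm (hf : IsCompositionSystem μ f) :
    IsCompositionSystem μ f.symm where
  absolutelyContinuous_image := hf.absolutelyContinuous_preimage
  absolutelyContinuous_preimage := hf.absolutelyContinuous_image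
  rnDeriv_image_bddBelow := hf.rnDeriv_preimage_bddBelow
  rnDeriv_preimage_bddBelow := hf.rnDeriv_image_bddBelow

theorem IsDissipativeGeneratedBy.symm (hW : IsDissipativeGeneratedBy μ f W) :
    IsDissipativeGeneratedBy μ f.symm W where
  measurableSet := hW.measurableSet
  measure_pos := hW.measure_pos
  measure_lt_top := hW.measure_lt_top
  pairwise_disjoint := fun j k hjk => by
    simp only [iterImage_symm]
    exact hW.pairwise_disjoint (neg_injective.ne hjk)
  iUnion_eq := by
    simp only [iterImage_symm]
    rw [← hW.iUnion_eq]
    exact (Equiv.neg ℤ).iSup_comp (g := fun k => iterImage f k W)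

theorem HasBoundedDistortion.symm (h : HasBoundedDistortion μ f W) :
    HasBoundedDistortion μ f.symm W := by
  obtain ⟨K, hK, h⟩ := h
  refine ⟨K, hK, fun k B => ?_⟩
  simp only [iterImage_symm]
  exact h (-k) B

theorem IsCompositionSystem.quasiMeasurePreserving_iterEquiv (hf : IsCompositionSystem μ f)
    (k : ℤ) : Measure.QuasiMeasurePreserving (iterEquiv f k) μ μ := by
  induction k with
  | zero =>
    convert Measure.QuasiMeasurePreserving.id μ using 1
    exact funext (iterEquiv_zero_apply f)
  | succ n ih =>
    convert ih.comp hf.quasiMeasurePreserving using 1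
    ext x
    rw [iterEquiv_add_apply, iterEquiv_one, Function.comp_apply]
  | pred n ih =>
    convert ih.comp hf.symm.quasiMeasurePreserving using 1
    ext x
    rw [sub_eq_add_neg, iterEquiv_add_apply, iterEquiv_neg_one, Function.comp_apply]

/-- Consecutive blocks have comparable measures, so shifting a block by `k` changes its measure at
most by a factor `C ^ |k|`. -/
theorem IsCompositionSystem.exists_measure_iterImage_add_le (hf : IsCompositionSystem μ f)
    (W : Set X) : ∃ C : ℝ≥0∞, C ≠ ∞ ∧ ∀ j k : ℤ,
      μ (iterImage f (j + k) W) ≤ C ^ k.natAbs * μ (iterImage f j W) := by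
  obtain ⟨C₁, hC₁, h₁⟩ := hf.exists_map_le
  obtain ⟨C₂, hC₂, h₂⟩ := hf.symm.exists_map_le
  have hpred : ∀ j : ℤ, μ (iterImage f (j - 1) W) ≤ max C₁ C₂ * μ (iterImage f j W) := by
    intro j
    have := h₁ (iterImage f j W)
    rw [MeasurableEquiv.map_apply, ← iterEquiv_one, preimage_iterImage] at this
    exact this.trans (mul_le_mul_left (le_max_left _ _) _)
  have hsucc : ∀ j : ℤ, μ (iterImage f (j + 1) W) ≤ max C₁ C₂ * μ (iterImage f j W) := by
    intro j
    have := h₂ (iterImage f j W)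
    rw [MeasurableEquiv.map_apply, ← iterEquiv_neg_one, preimage_iterImage, sub_neg_eq_add] at this
    exact this.trans (mul_le_mul_left (le_max_right _ _) _)
  refine ⟨max C₁ C₂, (max_lt hC₁.lt_top hC₂.lt_top).ne, fun j k => ?_⟩
  have hiter : ∀ n : ℕ,
      μ (iterImage f (j + n) W) ≤ max C₁ C₂ ^ n * μ (iterImage f j W) ∧
      μ (iterImage f (j - n) W) ≤ max C₁ C₂ ^ n * μ (iterImage f j W) := by
    intro n
    induction n with
    | zero => simp
    | succ n ih =>
      rw [pow_succ', mul_assoc, Nat.cast_succ, ← add_assoc, sub_add_eq_sub_sub]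
      exact ⟨(hsucc _).trans (mul_le_mul_right ih.1 _), (hpred _).trans (mul_le_mul_right ih.2 _)⟩
  obtain hk | hk := Int.natAbs_eq k
  · conv_lhs => rw [hk]
    exact (hiter _).1
  · conv_lhs => rw [hk, ← sub_eq_add_neg]
    exact (hiter _).2

theorem IsCompositionSystem.measure_iterImage_ne_top (hf : IsCompositionSystem μ f)
    (hW : IsDissipativeGeneratedBy μ f W) (k : ℤ) : μ (iterImage f k W) ≠ ∞ := by
  obtain ⟨C, hC, h⟩ := hf.exists_measure_iterImage_add_le W
  have := h 0 k
  rw [zero_add, iterImage_zero] at this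
  exact ne_top_of_le_ne_top (ENNReal.mul_ne_top (ENNReal.pow_ne_top hC) hW.measure_lt_top.ne) this

theorem IsCompositionSystem.measure_iterImage_ne_zero (hf : IsCompositionSystem μ f)
    (hW : IsDissipativeGeneratedBy μ f W) (k : ℤ) : μ (iterImage f k W) ≠ 0 := by
  obtain ⟨C, hC, h⟩ := hf.exists_measure_iterImage_add_le W
  intro h0
  have := h k (-k)
  rw [add_neg_cancel, iterImage_zero, h0, mul_zero] at this
  exact hW.measure_pos.ne' (nonpos_iff_eq_zero.1 this)

theorem IsDissipativeGeneratedBy.lintegral_eq_tsum (hW : IsDissipativeGeneratedBy μ f W)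
    (g : X → ℝ≥0∞) : ∫⁻ x, g x ∂μ = ∑' k : ℤ, ∫⁻ x in iterImage f k W, g x ∂μ := by
  rw [← lintegral_iUnion (measurableSet_iterImage hW.measurableSet) hW.pairwise_disjoint,
    hW.iUnion_eq, Measure.restrict_univ]

end Iterates

/-! ### Transport of integrals between blocks -/

section Distortion

variable {X : Type*} [MeasurableSpace X] {μ : Measure X} {f : X ≃ᵐ X} {W : Set X}

/-- Pulling the block `f ^ k (W)` back to `W` expresses the integral over it as an integral with
respect to the measure `B ↦ μ (f ^ k (B))`. -/
theorem setLIntegral_iterImage (g : X → ℝ≥0∞) (k : ℤ) :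
    ∫⁻ x in iterImage f k W, g x ∂μ =
      ∫⁻ x in W, g (iterEquiv f k x) ∂(μ.map (iterEquiv f (-k))) := by
  rw [MeasurableEquiv.restrict_map, lintegral_map_equiv, ← iterImage_eq_preimage]
  simp only [← iterEquiv_add_apply, add_neg_cancel, iterEquiv_zero_apply]

/-- Under bounded distortion, composition with `f ^ n` scales integrals over the block
`f ^ (k + n) (W)` by the ratio of the measures of the blocks, up to a constant independent of `k`,
`n` and the integrand. -/
theorem IsCompositionSystem.exists_setLIntegral_comp_le (hf : IsCompositionSystem μ f)
    (hW : IsDissipativeGeneratedBy μ f W) (hBD : HasBoundedDistortion μ f W) :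
    ∃ K : ℝ≥0∞, K ≠ ∞ ∧ ∀ (k n : ℤ) (g : X → ℝ≥0∞),
      μ (iterImage f (k + n) W) * ∫⁻ x in iterImage f k W, g (iterEquiv f n x) ∂μ ≤
        K * μ (iterImage f k W) * ∫⁻ x in iterImage f (k + n) W, g x ∂μ := by
  obtain ⟨K, hK, h⟩ := hBD
  have hK0 : (K : ℝ≥0∞) ≠ 0 := by exact_mod_cast hK.ne'
  have hnull : ∀ (k : ℤ) (B : Set X), μ B = 0 → μ (iterImage f k B) = 0 := by
    intro k B hB
    rw [iterImage_eq_preimage]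
    exact (hf.quasiMeasurePreserving_iterEquiv _).preimage_null hB
  have hle : ∀ k : ℤ, μ W • (μ.map (iterEquiv f (-k))).restrict W ≤
      (K * μ (iterImage f k W)) • μ.restrict W := by
    refine fun k => Measure.le_iff.2 fun s hs => ?_
    simp only [Measure.smul_apply, smul_eq_mul, Measure.restrict_apply hs,
      MeasurableEquiv.map_apply, ← iterImage_eq_preimage]
    by_cases h0 : μ (s ∩ W) = 0
    · rw [hnull k _ h0]; simp
    · have := (h k _ (hs.inter hW.measurableSet) Set.inter_subset_right
        (pos_iff_ne_zero.2 h0)).2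
      rwa [mul_comm (μ W), mul_assoc]
  have hge : ∀ k : ℤ, μ (iterImage f k W) • μ.restrict W ≤
      (K * μ W) • (μ.map (iterEquiv f (-k))).restrict W := by
    refine fun k => Measure.le_iff.2 fun s hs => ?_
    simp only [Measure.smul_apply, smul_eq_mul, Measure.restrict_apply hs,
      MeasurableEquiv.map_apply, ← iterImage_eq_preimage]
    by_cases h0 : μ (s ∩ W) = 0
    · rw [h0]; simp
    · have := (h k _ (hs.inter hW.measurableSet) Set.inter_subset_right
        (pos_iff_ne_zero.2 h0)).1
      rw [mul_assoc, mul_comm (μ W)]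
      rwa [ENNReal.inv_mul_le_iff hK0 ENNReal.coe_ne_top] at this
  have hle' : ∀ (k : ℤ) (g : X → ℝ≥0∞), μ W * ∫⁻ x in iterImage f k W, g x ∂μ ≤
      K * μ (iterImage f k W) * ∫⁻ x in W, g (iterEquiv f k x) ∂μ := by
    intro k g
    rw [setLIntegral_iterImage, ← smul_eq_mul, ← smul_eq_mul, ← lintegral_smul_measure,
      ← lintegral_smul_measure]
    exact lintegral_mono' (hle k) le_rfl
  have hge' : ∀ (k : ℤ) (g : X → ℝ≥0∞),
      μ (iterImage f k W) * ∫⁻ x in W, g (iterEquiv f k x) ∂μ ≤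
      K * μ W * ∫⁻ x in iterImage f k W, g x ∂μ := by
    intro k g
    rw [setLIntegral_iterImage, ← smul_eq_mul, ← smul_eq_mul (a := (K : ℝ≥0∞) * μ W),
      ← lintegral_smul_measure, ← lintegral_smul_measure]
    exact lintegral_mono' (hge k) le_rfl
  refine ⟨K * K, ENNReal.mul_ne_top ENNReal.coe_ne_top ENNReal.coe_ne_top, fun k n g => ?_⟩
  have h1 := hle' k (fun x => g (iterEquiv f n x))
  have h2 := hge' (k + n) g
  simp only [← iterEquiv_add_apply, add_comm n k] at h1
  rw [← ENNReal.mul_le_mul_iff_right hW.measure_pos.ne' hW.measure_lt_top.ne]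
  calc μ W * (μ (iterImage f (k + n) W) * ∫⁻ x in iterImage f k W, g (iterEquiv f n x) ∂μ)
      = μ (iterImage f (k + n) W) *
          (μ W * ∫⁻ x in iterImage f k W, g (iterEquiv f n x) ∂μ) := by ring
    _ ≤ μ (iterImage f (k + n) W) *
          (K * μ (iterImage f k W) * ∫⁻ x in W, g (iterEquiv f (k + n) x) ∂μ) := by gcongr
    _ = K * μ (iterImage f k W) *
          (μ (iterImage f (k + n) W) * ∫⁻ x in W, g (iterEquiv f (k + n) x) ∂μ) := by ring
    _ ≤ K * μ (iterImage f k W) *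
          (K * μ W * ∫⁻ x in iterImage f (k + n) W, g x ∂μ) := by gcongr
    _ = _ := by ring

end Distortion

/-! ### Powers of the composition operator -/

section Operator

variable {X : Type*} [MeasurableSpace X] {μ : Measure X} {f : X ≃ᵐ X} {W : Set X} {p : ℝ≥0∞}
  [Fact (1 ≤ p)]

theorem IsCompositionSystem.coeFn_compositionOperator_pow (hf : IsCompositionSystem μ f) (n : ℕ)
    (φ : Lp ℂ p μ) :
    (hf.compositionOperator p ^ n) φ =ᵐ[μ] fun x => φ (iterEquiv f n x) := by
  induction n with
  | zero =>
    simp only [pow_zero, Nat.cast_zero, iterEquiv_zero_apply]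
    rfl
  | succ n ih =>
    rw [pow_succ', mul_apply_eq_comp]
    refine (hf.coeFn_compositionOperator p _).trans ?_
    refine (hf.quasiMeasurePreserving.ae_eq_comp ih).trans (Eventually.of_forall fun x => ?_)
    simp only [Function.comp_apply, Nat.cast_succ, iterEquiv_add_apply, iterEquiv_one]

theorem IsCompositionSystem.compositionOperator_apply_symm (hf : IsCompositionSystem μ f)
    (φ : Lp ℂ p μ) : hf.compositionOperator p (hf.symm.compositionOperator p φ) = φ := by
  refine Lp.ext ((hf.coeFn_compositionOperator p _).trans ?_)
  refine (hf.quasiMeasurePreserving.ae_eq_comp (hf.symm.coeFn_compositionOperator p φ)).trans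
    (Eventually.of_forall fun x => ?_)
  simp

theorem ENNReal.toReal_pos_of_one_le (hp : p ≠ ∞) : 0 < p.toReal :=
  ENNReal.toReal_pos (zero_lt_one.trans_le Fact.out).ne' hp

theorem MeasureTheory.eLpNorm_rpow_eq_lintegral (hp : p ≠ ∞) (ν : Measure X) (φ : X → ℂ) :
    eLpNorm φ p ν ^ p.toReal = ∫⁻ x, ‖φ x‖ₑ ^ p.toReal ∂ν := by
  rw [eLpNorm_eq_lintegral_rpow_enorm_toReal (zero_lt_one.trans_le Fact.out).ne' hp,
    ← ENNReal.rpow_mul, one_div_mul_cancel (ENNReal.toReal_pos_of_one_le hp).ne', ENNReal.rpow_one]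

theorem MeasureTheory.Lp.enorm_rpow_eq_lintegral (hp : p ≠ ∞) (φ : Lp ℂ p μ) :
    ‖φ‖ₑ ^ p.toReal = ∫⁻ x, ‖φ x‖ₑ ^ p.toReal ∂μ := by
  rw [Lp.enorm_def, eLpNorm_rpow_eq_lintegral hp]

/-- A function supported on finitely many blocks is moved by `T ^ n` to blocks near `f ^ (-n) (W)`,
so the `p`-th power of its norm is bounded by a multiple of the measure of that block. -/
theorem IsCompositionSystem.exists_norm_pow_le_of_support (hf : IsCompositionSystem μ f)
    (hW : IsDissipativeGeneratedBy μ f W) (hBD : HasBoundedDistortion μ f W) (hp : p ≠ ∞)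
    (φ : Lp ℂ p μ) (s : Finset ℤ)
    (hφ : ∀ k ∉ s, ∫⁻ x in iterImage f k W, ‖φ x‖ₑ ^ p.toReal ∂μ = 0) :
    ∃ C : ℝ, ∀ n : ℕ, ‖(hf.compositionOperator p ^ n) φ‖ ^ p.toReal ≤
      C * (μ (iterImage f (-(n : ℤ)) W)).toReal := by
  obtain ⟨K, hK, hcomp⟩ := hf.exists_setLIntegral_comp_le hW hBD
  obtain ⟨C, hC, hratio⟩ := hf.exists_measure_iterImage_add_le W
  set g : X → ℝ≥0∞ := fun x => ‖φ x‖ₑ ^ p.toReal with hg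
  have hr := ENNReal.toReal_pos_of_one_le hp
  have hg_top : ∫⁻ x, g x ∂μ ≠ ∞ := by
    rw [hg, ← Lp.enorm_rpow_eq_lintegral hp]
    exact ENNReal.rpow_ne_top_of_nonneg hr.le enorm_ne_top
  set D : ℝ≥0∞ := ∑ j ∈ s, C ^ j.natAbs * (C ^ j.natAbs * K) * ∫⁻ x in iterImage f j W, g x ∂μ
    with hD
  have hD_top : D ≠ ∞ := by
    refine ENNReal.sum_ne_top.2 fun j _ => ?_
    have hCj : C ^ j.natAbs ≠ ∞ := ENNReal.pow_ne_top hC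
    exact ENNReal.mul_ne_top (ENNReal.mul_ne_top hCj (ENNReal.mul_ne_top hCj hK))
      (ne_top_of_le_ne_top hg_top (setLIntegral_le_lintegral _ _))
  have hblock : ∀ (n : ℕ) (j : ℤ),
      μ W * ∫⁻ x in iterImage f (j - n) W, g (iterEquiv f n x) ∂μ ≤
        C ^ j.natAbs * (C ^ j.natAbs * K) * (∫⁻ x in iterImage f j W, g x ∂μ) *
          μ (iterImage f (-(n : ℤ)) W) := by
    intro n j
    have h1 := hcomp (j - n) n g
    rw [sub_add_cancel] at h1
    have h2 := hratio j (-j)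
    rw [add_neg_cancel, iterImage_zero, Int.natAbs_neg] at h2
    have h3 := hratio (-n) j
    rw [neg_add_eq_sub] at h3
    calc μ W * ∫⁻ x in iterImage f (j - n) W, g (iterEquiv f n x) ∂μ
        ≤ C ^ j.natAbs * μ (iterImage f j W) *
            ∫⁻ x in iterImage f (j - n) W, g (iterEquiv f n x) ∂μ := by gcongr
      _ ≤ C ^ j.natAbs *
            (K * μ (iterImage f (j - n) W) * ∫⁻ x in iterImage f j W, g x ∂μ) := by
          rw [mul_assoc]; gcongr
      _ ≤ C ^ j.natAbs * (K * (C ^ j.natAbs * μ (iterImage f (-(n : ℤ)) W)) *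
            ∫⁻ x in iterImage f j W, g x ∂μ) := by gcongr
      _ = _ := by ring
  have hsum : ∀ n : ℕ, μ W * ∫⁻ x, g (iterEquiv f n x) ∂μ ≤
      D * μ (iterImage f (-(n : ℤ)) W) := by
    intro n
    rw [hW.lintegral_eq_tsum, ← (Equiv.subRight (n : ℤ)).tsum_eq, ← ENNReal.tsum_mul_left]
    refine (ENNReal.tsum_le_tsum (hblock n)).trans_eq ?_
    rw [ENNReal.tsum_mul_right, hD, tsum_eq_sum fun j hj => ?_]
    rw [hφ j hj, mul_zero]
  refine ⟨(D / μ W).toReal, fun n => ?_⟩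
  have hint : ‖(hf.compositionOperator p ^ n) φ‖ₑ ^ p.toReal =
      ∫⁻ x, g (iterEquiv f n x) ∂μ := by
    rw [Lp.enorm_rpow_eq_lintegral hp]
    exact lintegral_congr_ae ((hf.coeFn_compositionOperator_pow n φ).mono fun x hx => by
      simp only [hg, hx])
  rw [← toReal_enorm, ENNReal.toReal_rpow, ← ENNReal.toReal_mul, hint]
  refine ENNReal.toReal_mono (ENNReal.mul_ne_top (ENNReal.div_ne_top hD_top hW.measure_pos.ne')
    (hf.measure_iterImage_ne_top hW _)) ?_
  rw [ENNReal.mul_comm_div, ← mul_div_assoc, ENNReal.le_div_iff_mul_le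
    (Or.inl hW.measure_pos.ne') (Or.inl hW.measure_lt_top.ne), mul_comm]
  exact hsum n

/-- Functions supported on finitely many blocks are dense, since truncating to more and more blocks
leaves a tail of the convergent series of block integrals. -/
theorem IsCompositionSystem.dense_norm_pow_le (hf : IsCompositionSystem μ f)
    (hW : IsDissipativeGeneratedBy μ f W) (hBD : HasBoundedDistortion μ f W) (hp : p ≠ ∞) :
    Dense {φ : Lp ℂ p μ | ∃ C : ℝ, ∀ n : ℕ, ‖(hf.compositionOperator p ^ n) φ‖ ^ p.toReal ≤
      C * (μ (iterImage f (-(n : ℤ)) W)).toReal} := by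
  have hr := ENNReal.toReal_pos_of_one_le hp
  refine Metric.dense_iff.2 fun φ ε hε => ?_
  set I : ℤ → ℝ≥0∞ := fun k => ∫⁻ x in iterImage f k W, ‖φ x‖ₑ ^ p.toReal ∂μ with hI
  have hI_top : ∑' k, I k ≠ ∞ := by
    rw [hI, ← hW.lintegral_eq_tsum, ← Lp.enorm_rpow_eq_lintegral hp]
    exact ENNReal.rpow_ne_top_of_nonneg hr.le enorm_ne_top
  have hε' : 0 < ENNReal.ofReal ε ^ p.toReal :=
    ENNReal.rpow_pos (ENNReal.ofReal_pos.2 hε) ENNReal.ofReal_ne_top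
  obtain ⟨s, hs⟩ :=
    ((ENNReal.tendsto_tsum_compl_atTop_zero hI_top).eventually_lt_const hε').exists
  set A : Set X := ⋃ k ∈ s, iterImage f k W with hA
  have hmem : ∀ (k : ℤ), ∀ x ∈ iterImage f k W, x ∈ A ↔ k ∈ s := by
    intro k x hx
    simp only [hA, Set.mem_iUnion, exists_prop]
    refine ⟨fun ⟨j, hj, hxj⟩ => ?_, fun hk => ⟨k, hk, hx⟩⟩
    by_contra hk
    have hjk : j ≠ k := fun h => hk (h ▸ hj)
    exact Set.disjoint_left.1 (hW.pairwise_disjoint hjk) hxj hx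
  have hA_meas : MeasurableSet A :=
    s.measurableSet_biUnion fun k _ => measurableSet_iterImage hW.measurableSet k
  set ψ : Lp ℂ p μ := ((Lp.memLp φ).indicator hA_meas).toLp _
  have hψ_coe : ψ =ᵐ[μ] A.indicator φ := MemLp.coeFn_toLp _
  refine ⟨ψ, ?_, hf.exists_norm_pow_le_of_support hW hBD hp ψ s fun k hk => ?_⟩
  · have hint : ‖φ - ψ‖ₑ ^ p.toReal = ∑' k : {k // k ∉ s}, I k := by
      rw [Lp.enorm_rpow_eq_lintegral hp, hW.lintegral_eq_tsum]
      have hsub : ∑' k : {k // k ∉ s}, I k = ∑' k, ({k | k ∉ s} : Set ℤ).indicator I k :=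
        tsum_subtype ({k | k ∉ s} : Set ℤ) I
      rw [hsub]
      refine tsum_congr fun k => ?_
      have hcongr : ∀ᵐ x ∂μ, x ∈ iterImage f k W → ‖(φ - ψ : Lp ℂ p μ) x‖ₑ ^ p.toReal =
          if k ∈ s then 0 else ‖φ x‖ₑ ^ p.toReal := by
        filter_upwards [Lp.coeFn_sub φ ψ, hψ_coe] with x h1 h2 hx
        rw [h1, Pi.sub_apply, h2]
        by_cases hk : k ∈ s
        · rw [Set.indicator_of_mem ((hmem k x hx).2 hk), if_pos hk, sub_self, enorm_zero,
            ENNReal.zero_rpow_of_pos hr]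
        · rw [Set.indicator_of_notMem (fun h => hk ((hmem k x hx).1 h)), if_neg hk, sub_zero]
      rw [setLIntegral_congr_fun_ae (measurableSet_iterImage hW.measurableSet k) hcongr]
      by_cases hk : k ∈ s <;> simp [hk, hI]
    rw [Metric.mem_ball, dist_comm, dist_eq_norm]
    rw [← hint, ENNReal.rpow_lt_rpow_iff hr, ← ofReal_norm] at hs
    exact (ENNReal.ofReal_lt_ofReal_iff hε).1 hs
  · have hcongr : ∀ᵐ x ∂μ, x ∈ iterImage f k W → ‖ψ x‖ₑ ^ p.toReal = 0 := by
      filter_upwards [hψ_coe] with x h2 hx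
      rw [h2, Set.indicator_of_notMem (fun h => hk ((hmem k x hx).1 h)), enorm_zero,
        ENNReal.zero_rpow_of_pos hr]
    rw [setLIntegral_congr_fun_ae (measurableSet_iterImage hW.measurableSet k) hcongr,
      lintegral_zero]

end Operator

/-! ### Both implications -/

section Characterization

theorem ENNReal.liminf_atTop_eq_zero_iff {u : ℕ → ℝ≥0∞} :
    liminf u atTop = 0 ↔ ∀ δ : ℝ≥0∞, 0 < δ → ∃ᶠ n in atTop, u n < δ := by
  refine ⟨fun h δ hδ => frequently_lt_of_liminf_lt (h := h.trans_lt hδ), fun h => ?_⟩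
  by_contra h0
  obtain ⟨δ, hδ, hlt⟩ := exists_between (pos_iff_ne_zero.2 h0)
  refine h δ hδ ((eventually_lt_of_lt_liminf hlt).mono fun n hn => not_lt.2 hn.le)

variable {X : Type*} [MeasurableSpace X] {μ : Measure X} {f : X ≃ᵐ X} {W : Set X} {p : ℝ≥0∞}
  [Fact (1 ≤ p)]

theorem MeasureTheory.Lp.eLpNorm_restrict_sub_le {z χ : Lp ℂ p μ} {ε : ℝ} (h : ‖z - χ‖ < ε) (s : Set X) :
    eLpNorm (z - χ : X → ℂ) p (μ.restrict s) ≤ ENNReal.ofReal ε := by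
  calc eLpNorm (z - χ : X → ℂ) p (μ.restrict s)
      ≤ eLpNorm (z - χ : X → ℂ) p μ := eLpNorm_mono_measure _ Measure.restrict_le_self
    _ = ‖z - χ‖ₑ := by rw [Lp.enorm_def, eLpNorm_congr_ae (Lp.coeFn_sub z χ)]
    _ ≤ ENNReal.ofReal ε := by
      rw [← ofReal_norm]
      exact ENNReal.ofReal_le_ofReal h.le

/-- If both `x` and `lam • T ^ n x` are close to the indicator of `W`, then `x` is large on `W` and
small on `f ^ n (W)`, while `T ^ n x` is, relative to `lam`, large on `W` and small on
`f ^ (-n) (W)`. Comparing the blocks `W` and `f ^ n (W)` of `x`, and `f ^ (-n) (W)` and `W` of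
`T ^ n x`, and multiplying the two estimates, the scalar cancels. -/
theorem IsCompositionSystem.frequently_measure_mul_lt (hf : IsCompositionSystem μ f)
    (hW : IsDissipativeGeneratedBy μ f W) (hBD : HasBoundedDistortion μ f W) (hp : p ≠ ∞)
    (h : IsComplexSupercyclic (hf.compositionOperator p)) {δ : ℝ≥0∞} (hδ : 0 < δ) :
    ∃ᶠ n : ℕ in atTop, μ (iterImage f (-(n : ℤ)) W) * μ (iterImage f (n : ℤ) W) < δ := by
  obtain ⟨K, hK, hcomp⟩ := hf.exists_setLIntegral_comp_le hW hBD
  have hr := ENNReal.toReal_pos_of_one_le hp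
  set r := p.toReal with hr_def
  have hp0 : p ≠ 0 := (zero_lt_one.trans_le Fact.out).ne'
  set χ : Lp ℂ p μ := indicatorConstLp p hW.measurableSet hW.measure_lt_top.ne 1
  have hχ_coe : χ =ᵐ[μ] W.indicator fun _ => (1 : ℂ) := indicatorConstLp_coeFn
  set c : ℝ≥0∞ := eLpNorm χ p (μ.restrict W) with hc
  have hc_pos : 0 < c := by
    have h1 : χ =ᵐ[μ.restrict W] fun _ => (1 : ℂ) := by
      filter_upwards [ae_restrict_of_ae hχ_coe, ae_restrict_mem hW.measurableSet] with x hx hxW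
      rw [hx, Set.indicator_of_mem hxW]
    rw [hc, eLpNorm_congr_ae h1, eLpNorm_const' _ hp0 hp, Measure.restrict_apply_univ,
      enorm_one, one_mul]
    exact ENNReal.rpow_pos hW.measure_pos hW.measure_lt_top.ne
  have hc_top : c ≠ ∞ := ((Lp.memLp χ).restrict W).2.ne
  have hχ0 : χ ≠ 0 := by
    intro h0
    rw [hc, h0, eLpNorm_congr_ae (ae_restrict_of_ae (Lp.coeFn_zero ℂ p μ)), eLpNorm_zero] at hc_pos
    exact hc_pos.false
  have hχ_off : ∀ k : ℤ, k ≠ 0 → eLpNorm χ p (μ.restrict (iterImage f k W)) = 0 := by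
    intro k hk
    have hdisj : Disjoint (iterImage f k W) (iterImage f 0 W) := hW.pairwise_disjoint hk
    rw [iterImage_zero] at hdisj
    have h1 : χ =ᵐ[μ.restrict (iterImage f k W)] 0 := by
      filter_upwards [ae_restrict_of_ae hχ_coe,
        ae_restrict_mem (measurableSet_iterImage hW.measurableSet k)] with x hx hxk
      rw [hx, Set.indicator_of_notMem (Set.disjoint_left.1 hdisj hxk), Pi.zero_apply]
    rw [eLpNorm_congr_ae h1, eLpNorm_zero]
  have hmeas : ∀ (z : Lp ℂ p μ) (s : Set X), AEStronglyMeasurable z (μ.restrict s) :=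
    fun z s => (Lp.aestronglyMeasurable z).restrict
  have hp1 : 1 ≤ p := Fact.out
  set Q : ℝ≥0∞ := (K * μ W) ^ 2 with hQ
  have hQ_top : Q ≠ ∞ := ENNReal.pow_ne_top (ENNReal.mul_ne_top hK hW.measure_lt_top.ne)
  have hc2_pos : 0 < c / 2 := ENNReal.half_pos hc_pos.ne'
  have hc2_top : c / 2 ≠ ∞ := ENNReal.div_ne_top hc_top two_ne_zero
  set d : ℝ≥0∞ := (c / 2) ^ r * (c / 2) ^ r with hd
  have hcr_pos : 0 < (c / 2) ^ r := ENNReal.rpow_pos hc2_pos hc2_top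
  have hd_pos : 0 < d := ENNReal.mul_pos hcr_pos.ne' hcr_pos.ne'
  -- `ε` is so small that the final estimate `a₋ₙ aₙ d ≤ Q ε ^ (2 r)`, where
  -- `aₖ = μ (f ^ k (W))`, forces `a₋ₙ aₙ < δ`.
  obtain ⟨ε, ⟨hεQ, hεc⟩, hε⟩ : ∃ ε : ℝ, (Q * ENNReal.ofReal ε ^ (r + r) < δ * d ∧
      ENNReal.ofReal ε < c / 2) ∧ 0 < ε := by
    have hofReal : Tendsto ENNReal.ofReal (nhdsWithin 0 (Set.Ioi 0)) (nhds 0) := by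
      simpa using (ENNReal.continuous_ofReal.tendsto 0).mono_left nhdsWithin_le_nhds
    have hpow : Tendsto (fun e : ℝ≥0∞ => Q * e ^ (r + r)) (nhds 0) (nhds 0) := by
      have := ENNReal.Tendsto.const_mul (a := Q)
        ((ENNReal.continuous_rpow_const (y := r + r)).tendsto 0) (Or.inr hQ_top)
      rwa [ENNReal.zero_rpow_of_pos (by positivity), mul_zero] at this
    exact ((((hpow.comp hofReal).eventually_lt_const (ENNReal.mul_pos hδ.ne' hd_pos.ne')).and
      (hofReal.eventually_lt_const hc2_pos)).and self_mem_nhdsWithin).exists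
  set e : ℝ≥0∞ := ENNReal.ofReal ε
  have hlarge : ∀ z : Lp ℂ p μ, ‖z - χ‖ < ε → c / 2 ≤ eLpNorm z p (μ.restrict W) := by
    intro z hz
    have h1 : c ≤ eLpNorm z p (μ.restrict W) + c / 2 := by
      have h2 := eLpNorm_sub_le (hmeas z W) ((hmeas z W).sub (hmeas χ W)) hp1
      rw [sub_sub_cancel] at h2
      exact h2.trans (by gcongr; exact (Lp.eLpNorm_restrict_sub_le hz W).trans hεc.le)
    exact (ENNReal.add_le_add_iff_right hc2_top).1 ((ENNReal.add_halves c).trans_le h1)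
  have hsmall : ∀ z : Lp ℂ p μ, ‖z - χ‖ < ε → ∀ k : ℤ, k ≠ 0 →
      eLpNorm z p (μ.restrict (iterImage f k W)) ≤ e := by
    intro z hz k hk
    have h2 := eLpNorm_add_le ((hmeas z (iterImage f k W)).sub (hmeas χ (iterImage f k W)))
      (hmeas χ (iterImage f k W)) hp1
    rw [sub_add_cancel, hχ_off k hk, add_zero] at h2
    exact h2.trans (Lp.eLpNorm_restrict_sub_le hz _)
  rw [frequently_atTop]
  intro N
  obtain ⟨n, hn, x, lam, hx, hy⟩ := h.exists_approx
    (fun φ => ⟨_, hf.compositionOperator_apply_symm φ⟩) hχ0 hε (N + 1)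
  refine ⟨n, by omega, ?_⟩
  set y := (hf.compositionOperator p ^ n) x with hy_def
  have hy_coe : y =ᵐ[μ] fun w => x (iterEquiv f n w) := hf.coeFn_compositionOperator_pow n x
  have hx_coe : x =ᵐ[μ] fun w => y (iterEquiv f (-n) w) := by
    refine EventuallyEq.symm (((hf.quasiMeasurePreserving_iterEquiv (-n)).ae_eq_comp hy_coe).trans
      (Eventually.of_forall fun w => ?_))
    simp only [Function.comp_apply, ← iterEquiv_add_apply, add_neg_cancel, iterEquiv_zero_apply]
  have hscale : ∀ s : Set X, eLpNorm (lam • y : Lp ℂ p μ) p (μ.restrict s) =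
      ‖lam‖ₑ * eLpNorm y p (μ.restrict s) := by
    intro s
    rw [eLpNorm_congr_ae (ae_restrict_of_ae (Lp.coeFn_smul lam y)), eLpNorm_const_smul]
  -- `n ≥ N + 1` keeps the exponents `n` and `-n` away from `0`, so both blocks miss `W`.
  have hx0 := hlarge x hx
  have hxn := hsmall x hx n (by omega)
  have hy0 := hlarge _ hy
  have hyn := hsmall _ hy (-n) (by omega)
  rw [hscale] at hy0 hyn
  have hforward : μ (iterImage f n W) * eLpNorm y p (μ.restrict W) ^ r ≤
      K * μ W * eLpNorm x p (μ.restrict (iterImage f n W)) ^ r := by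
    have := hcomp 0 n fun w => ‖x w‖ₑ ^ r
    rw [zero_add, iterImage_zero] at this
    rwa [eLpNorm_congr_ae (ae_restrict_of_ae hy_coe), hr_def, eLpNorm_rpow_eq_lintegral hp,
      eLpNorm_rpow_eq_lintegral hp]
  have hbackward : μ (iterImage f (-n) W) * eLpNorm x p (μ.restrict W) ^ r ≤
      K * μ W * eLpNorm y p (μ.restrict (iterImage f (-n) W)) ^ r := by
    have := hcomp 0 (-n) fun w => ‖y w‖ₑ ^ r
    rw [zero_add, iterImage_zero] at this
    rwa [eLpNorm_congr_ae (ae_restrict_of_ae hx_coe), hr_def, eLpNorm_rpow_eq_lintegral hp,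
      eLpNorm_rpow_eq_lintegral hp]
  have hprod : μ (iterImage f (-n) W) * μ (iterImage f n W) * d ≤ Q * e ^ (r + r) := by
    calc μ (iterImage f (-n) W) * μ (iterImage f n W) * d
        ≤ μ (iterImage f (-n) W) * μ (iterImage f n W) *
            (eLpNorm x p (μ.restrict W) ^ r *
              (‖lam‖ₑ * eLpNorm y p (μ.restrict W)) ^ r) := by rw [hd]; gcongr
      _ = ‖lam‖ₑ ^ r * ((μ (iterImage f (-n) W) * eLpNorm x p (μ.restrict W) ^ r) *
            (μ (iterImage f n W) * eLpNorm y p (μ.restrict W) ^ r)) := by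
          rw [ENNReal.mul_rpow_of_nonneg _ _ hr.le]; ring
      _ ≤ ‖lam‖ₑ ^ r * ((K * μ W * eLpNorm y p (μ.restrict (iterImage f (-n) W)) ^ r) *
            (K * μ W * eLpNorm x p (μ.restrict (iterImage f n W)) ^ r)) := by gcongr
      _ = Q * ((‖lam‖ₑ * eLpNorm y p (μ.restrict (iterImage f (-n) W))) ^ r *
            eLpNorm x p (μ.restrict (iterImage f n W)) ^ r) := by
          rw [ENNReal.mul_rpow_of_nonneg _ _ hr.le, hQ]; ring
      _ ≤ Q * (e ^ r * e ^ r) := by gcongr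
      _ = Q * e ^ (r + r) := by rw [ENNReal.rpow_add_of_nonneg _ _ hr.le hr.le]
  exact lt_of_mul_lt_mul_right' (hprod.trans_lt hεQ)

/-- The criterion applies with the composition operators of `f` and `f.symm`: the two decay rates
are the measures of `f ^ (-n) (W)` and `f ^ n (W)`. -/
theorem IsCompositionSystem.isComplexSupercyclic_of_frequently (hf : IsCompositionSystem μ f)
    (hW : IsDissipativeGeneratedBy μ f W) (hBD : HasBoundedDistortion μ f W) (hp : p ≠ ∞)
    [SecondCountableTopology (Lp ℂ p μ)]
    (h : ∀ δ : ℝ≥0∞, 0 < δ → ∃ᶠ n : ℕ in atTop,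
      μ (iterImage f (-(n : ℤ)) W) * μ (iterImage f (n : ℤ) W) < δ) :
    IsComplexSupercyclic (hf.compositionOperator p) := by
  have hpos : ∀ k : ℤ, 0 < (μ (iterImage f k W)).toReal := fun k =>
    ENNReal.toReal_pos (hf.measure_iterImage_ne_zero hW k) (hf.measure_iterImage_ne_top hW k)
  refine isComplexSupercyclic_of_dense_bounds _ (hf.symm.compositionOperator p)
    hf.compositionOperator_apply_symm (ENNReal.toReal_pos_of_one_le hp)
    (u := fun n => (μ (iterImage f n W)).toReal) (v := fun n => (μ (iterImage f (-n) W)).toReal)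
    (fun n => hpos n) (fun n => hpos (-n)) (fun δ hδ => ?_) (hf.dense_norm_pow_le hW hBD hp) ?_
  · obtain ⟨n, hn⟩ := (h _ (ENNReal.ofReal_pos.2 hδ)).exists
    refine ⟨n, ?_⟩
    rw [← ENNReal.toReal_mul]
    exact ENNReal.toReal_lt_of_lt_ofReal hn
  · have := hf.symm.dense_norm_pow_le hW.symm hBD.symm hp
    simpa only [iterImage_symm, neg_neg] using this

/-- Moving the centre of the two blocks from `0` to `q` changes their measures by a factor that does
not depend on `n`. -/
theorem IsCompositionSystem.liminf_shift_eq_zero (hf : IsCompositionSystem μ f)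
    (h : liminf (fun n : ℕ =>
      μ (iterImage f (-(n : ℤ)) W) * μ (iterImage f (n : ℤ) W)) atTop = 0) (q : ℤ) :
    liminf (fun n : ℕ =>
      μ (iterImage f (q - n) W) * μ (iterImage f (q + n) W)) atTop = 0 := by
  obtain ⟨C, hC, hratio⟩ := hf.exists_measure_iterImage_add_le W
  set D : ℝ≥0∞ := C ^ q.natAbs * C ^ q.natAbs with hD
  have hD_top : D ≠ ∞ := ENNReal.mul_ne_top (ENNReal.pow_ne_top hC) (ENNReal.pow_ne_top hC)
  rw [ENNReal.liminf_atTop_eq_zero_iff] at h ⊢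
  intro δ hδ
  refine (h _ (ENNReal.div_pos hδ.ne' hD_top)).mono fun n hn => ?_
  have h1 := hratio (-n) q
  have h2 := hratio n q
  rw [neg_add_eq_sub] at h1
  rw [add_comm] at h2
  calc μ (iterImage f (q - n) W) * μ (iterImage f (q + n) W)
      ≤ (C ^ q.natAbs * μ (iterImage f (-n) W)) * (C ^ q.natAbs * μ (iterImage f n W)) := by
        gcongr
    _ = (μ (iterImage f (-n) W) * μ (iterImage f n W)) * D := by rw [hD]; ring
    _ < δ := ENNReal.mul_lt_of_lt_div hn

end Characterization

theorem theorem4p7 {X : Type*} [TopologicalSpace X] [T2Space X] [LocallyCompactSpace X]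
    [SigmaCompactSpace X] [SecondCountableTopology X] [MeasurableSpace X] [BorelSpace X]
    (μ : Measure X) [IsLocallyFiniteMeasure μ] (p : ℝ≥0∞) [Fact (1 ≤ p)] (hp : p ≠ ∞)
    (f : X ≃ᵐ X) (hf : IsCompositionSystem μ f) (W : Set X)
    (hW : IsDissipativeGeneratedBy μ f W) (hBD : HasBoundedDistortion μ f W) :
    (IsComplexSupercyclic (hf.compositionOperator p) ↔
      ∀ q : ℕ, liminf (fun n : ℕ =>
        μ (iterImage f ((q : ℤ) - n) W) * μ (iterImage f ((q : ℤ) + n) W)) atTop = 0) ∧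
    (IsComplexSupercyclic (hf.compositionOperator p) ↔
      liminf (fun n : ℕ =>
        μ (iterImage f (-(n : ℤ)) W) * μ (iterImage f (n : ℤ) W)) atTop = 0) := by
  have : Fact (p ≠ ∞) := ⟨hp⟩
  have hiff : IsComplexSupercyclic (hf.compositionOperator p) ↔
      liminf (fun n : ℕ =>
        μ (iterImage f (-(n : ℤ)) W) * μ (iterImage f (n : ℤ) W)) atTop = 0 := by
    rw [ENNReal.liminf_atTop_eq_zero_iff]
    exact ⟨fun h δ hδ => hf.frequently_measure_mul_lt hW hBD hp h hδ,
      hf.isComplexSupercyclic_of_frequently hW hBD hp⟩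
  refine ⟨hiff.trans ⟨fun h q => hf.liminf_shift_eq_zero h q, fun h => ?_⟩, hiff⟩
  simpa only [Nat.cast_zero, zero_sub, zero_add] using h 0
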